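/- All graphs are finite and simple. The \emph{circumference} of a graph $G$ is the length of a longest cycle of $G$ if $G$ contains a cycle, and is $2$ if $G$ is a forest. An $m$-colouring of $G$ assigns one of $m$ colours to each vertex (adjacent vertices may get the same colour); a monochromatic component is a connected component of the subgraph induced by all vertices of one colour. A colouring has \emph{clustering} $c$ if each monochromatic component has at most $c$ vertices, and \emph{defect} $d$ if each vertex has at most $d$ neighbours of its own colour. For a class $\mathcal{G}$ of graphs, the clustered chromatic number $\chi_\star(\mathcal{G})$ (respectively, the defective chromatic number $\chi_\Delta(\mathcal{G})$) is the minimum integer $m$ for which there is an integer $c$ such that every graph in $\mathcal{G}$ has an $m$-colouring with clustering $c$ (respectively, with defect $c$), and is $\infty$ if there is no such $m$. Let $\mathcal{C}_k$ be the class of graphs with circumference at most $k$, and let $\mathcal{H}_k$ be the class of graphs that contain no path on $k+1$ vertices. \textbf{Theorem.} Let $k\geq 2$ be an integer. \begin{enumerate} \item Every graph with circumference at most $k$ is $\lfloor 3\log_2 k\rfloor$-colourable with clustering $k$. Thus $\chi_\Delta(\mathcal{C}_k)\leq\chi_\star(\mathcal{C}_k)\leq \lfloor 3\log_2 k\rfloor$.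 \item Every graph containing no path on $k+1$ vertices is $\lfloor 3\log_2 k\rfloor$-colourable with clustering $k$. Thus $\chi_\Delta(\mathcal{H}_k)\leq\chi_\star(\mathcal{H}_k)\leq \lfloor 3\log_2 k\rfloor$. \end{enumerate} -/

import Mathlib

universe u

namespace SimpleGraph

variable {V : Type u}

/-- A colouring `f` (not necessarily proper) has clustering `c` if each monochromatic component,
that is, each connected component of the subgraph induced by a colour class, has at most `c`
vertices. (Used for finite graphs.) -/
def HasClustering (G : SimpleGraph V) {m : ℕ} (f : V → Fin m) (c : ℕ) : Prop :=
  ∀ i : Fin m, ∀ K : (G.induce {v | f v = i}).ConnectedComponent, K.supp.ncard ≤ c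

/-- A colouring `f` (not necessarily proper) has defect `d` if each vertex has at most `d`
neighbours of its own colour. (Used for finite graphs.) -/
def HasDefect (G : SimpleGraph V) {m : ℕ} (f : V → Fin m) (d : ℕ) : Prop :=
  ∀ v : V, {w | G.Adj v w ∧ f w = f v}.ncard ≤ d

/-- `G` is `m`-colourable with clustering `c`. -/
def ColorableWithClustering (G : SimpleGraph V) (m c : ℕ) : Prop :=
  ∃ f : V → Fin m, G.HasClustering f c

/-- `G` is `m`-colourable with defect `d`. -/
def ColorableWithDefect (G : SimpleGraph V) (m d : ℕ) : Prop :=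
  ∃ f : V → Fin m, G.HasDefect f d

open Classical in
/-- The circumference of a finite graph: the length of a longest cycle, and `2` for a forest. -/
noncomputable def circumference (G : SimpleGraph V) : ℕ :=
  if G.IsAcyclic then 2
  else sSup {n : ℕ | ∃ (v : V) (w : G.Walk v v), w.IsCycle ∧ w.length = n}

/-- `G` contains a path with exactly `n` vertices (as a subgraph). -/
def HasPathOfOrder (G : SimpleGraph V) (n : ℕ) : Prop :=
  ∃ (u v : V) (p : G.Walk u v), p.IsPath ∧ p.support.length = n

/-- A class of graphs; below only its finite members matter. -/
abbrev GraphClass := ∀ ⦃V : Type u⦄, SimpleGraph V → Prop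

/-- The clustered chromatic number of a class of finite graphs: the least `m` such that for some
`c` every member is `m`-colourable with clustering `c`, and `⊤` if there is no such `m`. -/
noncomputable def clusteredChromaticNumber (𝒢 : GraphClass.{u}) : ℕ∞ :=
  ⨅ (m : ℕ) (_ : ∃ c : ℕ, ∀ (V : Type u) [Finite V] (G : SimpleGraph V), 𝒢 G →
    G.ColorableWithClustering m c), (m : ℕ∞)

/-- The defective chromatic number of a class of finite graphs: the least `m` such that for some
`d` every member is `m`-colourable with defect `d`, and `⊤` if there is no such `m`. -/
noncomputable def defectiveChromaticNumber (𝒢 : GraphClass.{u}) : ℕ∞ :=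
  ⨅ (m : ℕ) (_ : ∃ d : ℕ, ∀ (V : Type u) [Finite V] (G : SimpleGraph V), 𝒢 G →
    G.ColorableWithDefect m d), (m : ℕ∞)

/-- The class of graphs with circumference at most `k`. -/
def circumferenceClass (k : ℕ) : GraphClass.{u} := fun _ G => G.circumference ≤ k

/-- The class of graphs with no path on `k + 1` vertices. -/
def noLongPathClass (k : ℕ) : GraphClass.{u} := fun _ G => ¬ G.HasPathOfOrder (k + 1)

end SimpleGraph

namespace SimpleGraph

variable {V : Type u} {G H : SimpleGraph V} {A B S T : Set V}

/-- `S` meets every walk from `A` to `B`. -/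
def Separates (G : SimpleGraph V) (A B S : Set V) : Prop :=
  ∀ a ∈ A, ∀ b ∈ B, ∀ p : G.Walk a b, ∃ z ∈ p.support, z ∈ S

/-- There are `n` pairwise disjoint paths from `A` to `B`. -/
def Linked (G : SimpleGraph V) (A B : Set V) (n : ℕ) : Prop :=
  ∃ (a b : Fin n → V) (p : ∀ i, G.Walk (a i) (b i)),
    (∀ i, a i ∈ A) ∧ (∀ i, b i ∈ B) ∧ (∀ i, (p i).IsPath) ∧
      ∀ i j z, z ∈ (p i).support → z ∈ (p j).support → i = j

/-- The vertices that can be reached from `A` by a walk avoiding `S`. -/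
def reachAvoiding (G : SimpleGraph V) (A S : Set V) : Set V :=
  {z | ∃ a ∈ A, ∃ p : G.Walk a z, ∀ y ∈ p.support, y ∉ S}

lemma Separates.symm (h : G.Separates A B S) : G.Separates B A S := by
  intro b hb a ha p
  obtain ⟨z, hz, hzS⟩ := h a ha b hb p.reverse
  exact ⟨z, by simpa using hz, hzS⟩

lemma mem_reachAvoiding {a : V} (ha : a ∈ A) (haS : a ∉ S) : a ∈ G.reachAvoiding A S :=
  ⟨a, ha, .nil, by simpa using haS⟩

lemma notMem_of_mem_reachAvoiding {z : V} (h : z ∈ G.reachAvoiding A S) : z ∉ S := by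
  obtain ⟨a, -, p, hp⟩ := h
  exact hp _ p.end_mem_support

lemma mem_reachAvoiding_of_adj {y z : V} (h : y ∈ G.reachAvoiding A S) (hyz : G.Adj y z)
    (hz : z ∉ S) : z ∈ G.reachAvoiding A S := by
  obtain ⟨a, ha, p, hp⟩ := h
  refine ⟨a, ha, p.concat hyz, fun y hy ↦ ?_⟩
  rw [Walk.support_concat, List.mem_append] at hy
  rcases hy with hy | hy
  · exact hp y hy
  · rw [List.mem_singleton] at hy
    exact hy ▸ hz

lemma mem_reachAvoiding_of_mem_support {a y z : V} (ha : a ∈ A) (p : G.Walk a z)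
    (hp : ∀ y ∈ p.support, y ∉ S) (hy : y ∈ p.support) : y ∈ G.reachAvoiding A S := by
  classical
  exact ⟨a, ha, p.takeUntil y hy,
    fun x hx ↦ hp x (p.support_takeUntil_subset_support hy hx)⟩

lemma Separates.disjoint_reachAvoiding (h : G.Separates A B S) :
    Disjoint (G.reachAvoiding A S) (G.reachAvoiding B S) := by
  rw [Set.disjoint_left]
  rintro z ⟨a, ha, p, hp⟩ ⟨b, hb, q, hq⟩
  obtain ⟨y, hy, hyS⟩ := h a ha b hb (p.append q.reverse)
  rw [Walk.mem_support_append_iff, Walk.support_reverse, List.mem_reverse] at hy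
  exact hy.elim (fun hy ↦ hp y hy hyS) (fun hy ↦ hq y hy hyS)

lemma Separates.of_deleteEdges {x y : V}
    (hS : (G.deleteEdges {s(x, y)}).Separates A B S)
    (hy : y ∈ (G.deleteEdges {s(x, y)}).reachAvoiding B S)
    (hT : (G.deleteEdges {s(x, y)}).Separates A (insert x S) T) : G.Separates A B T := by
  intro a ha b hb p
  by_contra! hp
  set H := G.deleteEdges {s(x, y)} with hH
  have hdisj : ∀ z ∈ H.reachAvoiding A T, z ∉ insert x S := by
    rintro z ⟨a', ha', q, hq⟩ hz
    obtain ⟨w, hw, hwT⟩ := hT a' ha' z hz q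
    exact hq w hw hwT
  have key : ∀ z ∈ H.reachAvoiding A T, z ∈ H.reachAvoiding A S := by
    rintro z ⟨a', ha', q, hq⟩
    refine ⟨a', ha', q, fun w hw hwS ↦ ?_⟩
    exact hdisj w (mem_reachAvoiding_of_mem_support ha' q hq hw) (Set.mem_insert_of_mem _ hwS)
  have hbS : b ∉ H.reachAvoiding A T := by
    intro hbL
    have hbS := key b hbL
    exact hS.disjoint_reachAvoiding.le_bot
      ⟨hbS, mem_reachAvoiding hb (notMem_of_mem_reachAvoiding hbS)⟩
  obtain ⟨d, hd, hd1, hd2⟩ := p.exists_boundary_dart (H.reachAvoiding A T)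
    (mem_reachAvoiding ha (hp a p.start_mem_support)) hbS
  have hdT : d.snd ∉ T := hp _ (p.dart_snd_mem_support_of_mem_darts hd)
  have hde : s(d.fst, d.snd) = s(x, y) := by
    by_contra hne
    refine hd2 (mem_reachAvoiding_of_adj hd1 ?_ hdT)
    rw [hH, deleteEdges_adj]
    exact ⟨d.adj, hne⟩
  rw [Sym2.eq_iff] at hde
  rcases hde with ⟨h1, -⟩ | ⟨h1, -⟩
  · exact hdisj _ hd1 (h1 ▸ Set.mem_insert _ _)
  · exact hS.disjoint_reachAvoiding.le_bot ⟨key _ hd1, h1 ▸ hy⟩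

lemma Separates.exists_orientation {u v : V} (hS : (G.deleteEdges {s(u, v)}).Separates A B S)
    (hn : ¬ G.Separates A B S) :
    ∃ x y, s(x, y) = s(u, v) ∧ x ∈ (G.deleteEdges {s(u, v)}).reachAvoiding A S ∧
      y ∈ (G.deleteEdges {s(u, v)}).reachAvoiding B S := by
  set H := G.deleteEdges {s(u, v)} with hH
  simp only [Separates, not_forall] at hn
  obtain ⟨a, ha, b, hb, p, hp⟩ := hn
  push Not at hp
  have hdis := Set.disjoint_left.1 hS.disjoint_reachAvoiding
  have haA : a ∈ H.reachAvoiding A S := mem_reachAvoiding ha (hp a p.start_mem_support)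
  have hbB : b ∈ H.reachAvoiding B S := mem_reachAvoiding hb (hp b p.end_mem_support)
  obtain ⟨d, hd, hd1, hd2⟩ := p.exists_boundary_dart (H.reachAvoiding A S) haA
    (fun h ↦ hdis h hbB)
  have hde : s(d.fst, d.snd) = s(u, v) := by
    by_contra hne
    refine hd2 (mem_reachAvoiding_of_adj hd1 ?_ (hp _ (p.dart_snd_mem_support_of_mem_darts hd)))
    rw [hH, deleteEdges_adj]
    exact ⟨d.adj, hne⟩
  obtain ⟨e, he, he1, he2⟩ := p.reverse.exists_boundary_dart (H.reachAvoiding B S) hbB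
    (fun h ↦ hdis haA h)
  have hee : s(e.fst, e.snd) = s(u, v) := by
    by_contra hne
    refine he2 (mem_reachAvoiding_of_adj he1 ?_ (hp _ ?_))
    · rw [hH, deleteEdges_adj]
      exact ⟨e.adj, hne⟩
    · simpa using p.reverse.dart_snd_mem_support_of_mem_darts he
  refine ⟨d.fst, d.snd, hde, hd1, ?_⟩
  rw [← hde, Sym2.eq_iff] at hee
  rcases hee with ⟨h1, -⟩ | ⟨h1, -⟩
  · exact (hdis hd1 (h1 ▸ he1)).elim
  · exact h1 ▸ he1

lemma Linked.mono {n : ℕ} (hGH : G ≤ H) (h : G.Linked A B n) : H.Linked A B n := by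
  obtain ⟨a, b, p, ha, hb, hp, hd⟩ := h
  refine ⟨a, b, fun i ↦ (p i).mapLe hGH, ha, hb, fun i ↦ ?_, ?_⟩
  · exact (hp i).mapLe hGH
  · simpa using hd

/-- Two paths on the two sides of a separator only meet in the separator. -/
lemma Separates.eq_of_mem_support {a s t b z : V} (hS : G.Separates A B S) (ha : a ∈ A)
    (hb : b ∈ B) {p : G.Walk a s} {q : G.Walk t b} (hp : p.IsPath) (hq : q.IsPath)
    (hpS : ∀ w ∈ p.support, w ∈ S → w = s) (hqS : ∀ w ∈ q.support, w ∈ S → w = t)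
    (hzp : z ∈ p.support) (hzq : z ∈ q.support) : z ∈ S ∧ s = z ∧ t = z := by
  classical
  have hzS : z ∈ S := by
    obtain ⟨w, hw, hwS⟩ := hS a ha b hb
      ((p.takeUntil z hzp).append (q.reverse.takeUntil z (by simpa using hzq)).reverse)
    rw [Walk.mem_support_append_iff, Walk.support_reverse, List.mem_reverse] at hw
    rcases hw with hw | hw
    · obtain rfl := hpS w (p.support_takeUntil_subset_support hzp hw) hwS
      by_contra hzS
      exact Walk.endpoint_notMem_support_takeUntil hp hzp (fun h ↦ hzS (h ▸ hwS)) hw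
    · have hw' := Walk.support_takeUntil_subset_support _ _ hw
      rw [Walk.support_reverse, List.mem_reverse] at hw'
      obtain rfl := hqS w hw' hwS
      by_contra hzS
      exact Walk.endpoint_notMem_support_takeUntil hq.reverse (by simpa using hzq)
        (fun h : w = z ↦ hzS (h ▸ hwS)) hw
  exact ⟨hzS, (hpS z hzp hzS).symm, (hqS z hzq hzS).symm⟩

/-- Disjoint paths on the two sides of a separator of an edge-deleted graph combine. -/
lemma linked_of_linked_deleteEdges [Finite V] {n : ℕ} {x y : V} (hxy : G.Adj x y)
    (hS : (G.deleteEdges {s(x, y)}).Separates A B S)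
    (hx : (insert x S).ncard = n) (hy : (insert y S).ncard = n) (hyS : y ∉ S)
    (h₁ : (G.deleteEdges {s(x, y)}).Linked A (insert x S) n)
    (h₂ : (G.deleteEdges {s(x, y)}).Linked (insert y S) B n) : G.Linked A B n := by
  classical
  have hle : G.deleteEdges {s(x, y)} ≤ G := deleteEdges_le _
  obtain ⟨a₁, b₁, p, ha₁, hb₁, hp, hpd⟩ := h₁
  obtain ⟨a₂, b₂, q, ha₂, hb₂, hq, hqd⟩ := h₂
  have surj : ∀ (T : Set V) (f : Fin n → V), T.ncard = n → (∀ i, f i ∈ T) →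
      Function.Injective f → ∀ z ∈ T, ∃ i, f i = z := by
    intro T f hT hf hinj z hz
    have hr : Set.range f = T := by
      refine Set.eq_of_subset_of_ncard_le (by rintro _ ⟨i, rfl⟩; exact hf i) ?_ (Set.toFinite _)
      rw [hT, ← Set.image_univ, Set.ncard_image_of_injective _ hinj, Set.ncard_univ]
      simp
    rwa [← hr] at hz
  have hb₁s := surj _ b₁ hx hb₁ fun i j hij ↦
    hpd i j (b₁ i) (p i).end_mem_support (by rw [hij]; exact (p j).end_mem_support)
  have ha₂s := surj _ a₂ hy ha₂ fun i j hij ↦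
    hqd i j (a₂ i) (q i).start_mem_support (by rw [hij]; exact (q j).start_mem_support)
  have hpS : ∀ i, ∀ w ∈ (p i).support, w ∈ S → w = b₁ i := by
    intro i w hw hwS
    obtain ⟨j, hj⟩ := hb₁s w (Set.mem_insert_of_mem _ hwS)
    rw [hpd i j w hw (hj ▸ (p j).end_mem_support), hj]
  have hqS : ∀ i, ∀ w ∈ (q i).support, w ∈ S → w = a₂ i := by
    intro i w hw hwS
    obtain ⟨j, hj⟩ := ha₂s w (Set.mem_insert_of_mem _ hwS)
    rw [hqd i j w hw (hj ▸ (q j).start_mem_support), hj]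
  have hmatch : ∀ i, ∃ j, (b₁ i ∈ S ∧ a₂ j = b₁ i) ∨ (b₁ i = x ∧ a₂ j = y) := by
    intro i
    rcases hb₁ i with h | h
    · obtain ⟨j, hj⟩ := ha₂s y (Set.mem_insert _ _)
      exact ⟨j, .inr ⟨h, hj⟩⟩
    · obtain ⟨j, hj⟩ := ha₂s (b₁ i) (Set.mem_insert_of_mem _ h)
      exact ⟨j, .inl ⟨h, hj⟩⟩
  choose σ hσ using hmatch
  have hσinj : Function.Injective σ := by
    intro i j hij
    have hbb : b₁ i = b₁ j := by
      rcases hσ i with ⟨h1, h2⟩ | ⟨h1, h2⟩ <;> rcases hσ j with ⟨h3, h4⟩ | ⟨h3, h4⟩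
      · rw [← h2, ← h4, hij]
      · exact (hyS (by rw [← h4, ← hij, h2]; exact h1)).elim
      · exact (hyS (by rw [← h2, hij, h4]; exact h3)).elim
      · rw [h1, h3]
    exact hpd i j (b₁ i) (p i).end_mem_support (by rw [hbb]; exact (p j).end_mem_support)
  have hcross : ∀ i j z, z ∈ (p i).support → z ∈ (q (σ j)).support → i = j := by
    intro i j z hz hz'
    obtain ⟨hzS, h1, h2⟩ := hS.eq_of_mem_support (ha₁ i) (hb₂ _) (hp i) (hq _) (hpS i) (hqS _) hz hz'
    rcases hσ j with ⟨-, h4⟩ | ⟨-, h4⟩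
    · have : z = b₁ j := by rw [← h2, h4]
      exact hpd i j z hz (this ▸ (p j).end_mem_support)
    · exact (hyS (by rw [← h4, h2]; exact hzS)).elim
  have hwalk : ∀ i, ∃ r : G.Walk (a₁ i) (b₂ (σ i)), r.IsPath ∧
      ∀ z ∈ r.support, z ∈ (p i).support ∨ z ∈ (q (σ i)).support := by
    intro i
    obtain ⟨r, hr⟩ : ∃ r : G.Walk (a₁ i) (b₂ (σ i)),
        ∀ z ∈ r.support, z ∈ (p i).support ∨ z ∈ (q (σ i)).support := by
      rcases hσ i with ⟨-, h⟩ | ⟨h, h'⟩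
      · refine ⟨((p i).mapLe hle).append (((q (σ i)).mapLe hle).copy h rfl), fun z hz ↦ ?_⟩
        simpa [Walk.mem_support_append_iff] using hz
      · refine ⟨((p i).mapLe hle).append (.cons (h.symm ▸ h'.symm ▸ hxy)
          ((q (σ i)).mapLe hle)), fun z hz ↦ ?_⟩
        rw [Walk.mem_support_append_iff, Walk.support_cons, List.mem_cons] at hz
        simp only [Walk.support_mapLe_eq_support] at hz
        rcases hz with hz | rfl | hz
        · exact .inl hz
        · exact .inl (p i).end_mem_support
        · exact .inr hz
    exact ⟨r.bypass, r.bypass_isPath, fun z hz ↦ hr z (r.support_bypass_subset_support hz)⟩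
  choose r hr hrs using hwalk
  refine ⟨a₁, fun i ↦ b₂ (σ i), r, ha₁, fun i ↦ hb₂ _, hr, fun i j z hi hj ↦ ?_⟩
  rcases hrs i z hi with hi | hi <;> rcases hrs j z hj with hj | hj
  · exact hpd i j z hi hj
  · exact hcross i j z hi hj
  · exact (hcross j i z hj hi).symm
  · exact hσinj (hqd _ _ z hi hj)

/-- **Menger's theorem**, for sets of vertices in a finite graph. -/
theorem linked_of_forall_separates [Finite V] (n : ℕ) (G : SimpleGraph V) (A B : Set V)
    (h : ∀ S, G.Separates A B S → n ≤ S.ncard) : G.Linked A B n := by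
  classical
  induction G using WellFoundedLT.induction generalizing A B with
  | ind G ih =>
  by_cases hG : ∃ u v, G.Adj u v
  · obtain ⟨u, v, huv⟩ := hG
    have hlt : ∀ x y, G.Adj x y → G.deleteEdges {s(x, y)} < G := by
      intro x y hxy
      refine lt_of_le_of_ne (deleteEdges_le _) fun heq ↦ ?_
      have : (G.deleteEdges {s(x, y)}).Adj x y := by rwa [heq]
      simp [deleteEdges_adj] at this
    by_cases hS : ∀ S, (G.deleteEdges {s(u, v)}).Separates A B S → n ≤ S.ncard
    · exact (ih _ (hlt u v huv) A B hS).mono (deleteEdges_le _)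
    push Not at hS
    obtain ⟨S, hS, hSn⟩ := hS
    obtain ⟨x, y, hxy, hx, hy⟩ := hS.exists_orientation fun hGS ↦ (h S hGS).not_gt hSn
    rw [← hxy] at hS hx hy
    have hadj : G.Adj x y := by
      rw [← mem_edgeSet, hxy]
      exact huv
    have hsym : s(x, y) = s(y, x) := Sym2.eq_swap
    have hA : ∀ T, (G.deleteEdges {s(x, y)}).Separates A (insert x S) T → n ≤ T.ncard :=
      fun T hT ↦ h T (Separates.of_deleteEdges hS hy hT)
    have hB : ∀ T, (G.deleteEdges {s(x, y)}).Separates (insert y S) B T → n ≤ T.ncard := by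
      intro T hT
      rw [hsym] at hS hx hT
      exact h T (Separates.of_deleteEdges hS.symm hx hT.symm).symm
    have hxS : x ∉ S := notMem_of_mem_reachAvoiding hx
    have hyS : y ∉ S := notMem_of_mem_reachAvoiding hy
    have hxn := hA (insert x S) fun a _ b hb p ↦ ⟨b, p.end_mem_support, hb⟩
    have hyn := hB (insert y S) fun a ha b _ p ↦ ⟨a, p.start_mem_support, ha⟩
    have h1 := Set.ncard_insert_of_notMem hxS (Set.toFinite _)
    have h2 := Set.ncard_insert_of_notMem hyS (Set.toFinite _)
    exact linked_of_linked_deleteEdges hadj hS (by omega) (by omega) hyS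
      (ih _ (hlt x y hadj) _ _ hA) (ih _ (hlt x y hadj) _ _ hB)
  · push Not at hG
    have hn := h (A ∩ B) fun a ha b hb p ↦ by
      cases p with
      | nil => exact ⟨a, by simp, ha, hb⟩
      | cons hadj _ => exact (hG _ _ hadj).elim
    obtain ⟨e⟩ : Nonempty (Fin n ↪ ↥(A ∩ B)) := by
      have := Fintype.ofFinite ↥(A ∩ B)
      refine Function.Embedding.nonempty_of_card_le ?_
      rw [Fintype.card_fin, ← Nat.card_eq_fintype_card]
      exact hn
    refine ⟨fun i ↦ e i, fun i ↦ e i, fun i ↦ .nil, fun i ↦ (e i).2.1, fun i ↦ (e i).2.2,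
      fun i ↦ .nil, fun i j z hi hj ↦ ?_⟩
    simp only [Walk.support_nil, List.mem_singleton] at hi hj
    exact e.injective (Subtype.ext (hi.symm.trans hj))

namespace Walk

lemma IsPath.append_of_forall_eq {u v w : V} {p : G.Walk u v} {q : G.Walk v w} (hp : p.IsPath)
    (hq : q.IsPath) (h : ∀ z ∈ p.support, z ∈ q.support → z = v) : (p.append q).IsPath := by
  rw [isPath_def, support_append, List.nodup_append']
  refine ⟨hp.support_nodup, hq.support_nodup.tail, fun z hz hz' ↦ ?_⟩
  obtain rfl := h z hz (List.mem_of_mem_tail hz')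
  have := hq.support_nodup
  rw [← cons_tail_support, List.nodup_cons] at this
  exact this.1 hz'

lemma IsPath.isCycle_append_reverse {u v : V} {p q : G.Walk u v} (hp : p.IsPath)
    (hq : q.IsPath) (hl : 1 < p.length) (h : ∀ z ∈ p.support, z ∈ q.support → z = u ∨ z = v) :
    (p.append q.reverse).IsCycle := by
  refine hp.isCycle_append hq.reverse (fun z hz hz' ↦ ?_) (.inl hl)
  have h1 := hp.support_nodup
  have h2 := hq.reverse.support_nodup
  rw [← cons_tail_support, List.nodup_cons] at h1 h2
  have hzq : z ∈ q.support := by simpa using List.mem_of_mem_tail hz'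
  rcases h z (List.mem_of_mem_tail hz) hzq with rfl | rfl
  · exact h1.1 hz
  · exact h2.1 hz'

lemma IsCycle.append_comm {u v : V} {p : G.Walk u v} {q : G.Walk v u}
    (h : (p.append q).IsCycle) : (q.append p).IsCycle := by
  rw [isCycle_def, isTrail_def, edges_append, tail_support_append] at h ⊢
  refine ⟨List.perm_append_comm.nodup_iff.1 h.1, fun hn ↦ h.2.1 ?_,
    List.perm_append_comm.nodup_iff.1 h.2.2⟩
  have := congrArg length hn
  rw [length_append, length_nil] at this
  rw [eq_nil_iff_nil, ← length_eq_zero_iff, length_append]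
  omega

/-- Three vertices of a cycle are pairwise joined by paths inside the cycle which together
traverse the cycle twice. -/
lemma IsCycle.exists_arcs {v x y z : V} {c : G.Walk v v} (hc : c.IsCycle) (hx : x ∈ c.support)
    (hy : y ∈ c.support) (hz : z ∈ c.support) (hxy : x ≠ y) (hyz : y ≠ z) (hzx : z ≠ x) :
    ∃ (p : G.Walk x y) (q : G.Walk y z) (r : G.Walk z x), p.IsPath ∧ q.IsPath ∧ r.IsPath ∧
      p.support ⊆ c.support ∧ q.support ⊆ c.support ∧ r.support ⊆ c.support ∧
      p.length + q.length + r.length = 2 * c.length := by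
  classical
  obtain ⟨d, hd, hdl, hds⟩ : ∃ d : G.Walk x x, d.IsCycle ∧ d.length = c.length ∧
      ∀ z, z ∈ d.support ↔ z ∈ c.support :=
    ⟨c.rotate x hx, hc.rotate hx, by simp, by simp⟩
  obtain ⟨p, q, rfl⟩ := mem_support_iff_exists_append.1 ((hds y).2 hy)
  rw [length_append] at hdl
  simp only [mem_support_append_iff] at hds
  rcases (hds z).2 hz with h | h
  · obtain ⟨p₁, p₂, rfl⟩ := mem_support_iff_exists_append.1 h
    rw [length_append] at hdl
    simp only [mem_support_append_iff] at hds
    have hd' := hd.append_comm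
    rw [← append_assoc] at hd
    have hd₂ := hd.append_comm
    rw [← append_assoc] at hd₂
    refine ⟨p₁.append p₂, q.append p₁, p₂.append q, ?_, ?_, ?_, ?_, ?_, ?_, ?_⟩
    · exact hd'.isPath_of_append_right (not_nil_of_ne hxy.symm)
    · exact hd₂.isPath_of_append_right (not_nil_of_ne hyz.symm)
    · exact hd.isPath_of_append_right (not_nil_of_ne hzx.symm)
    · intro w; rw [← hds, mem_support_append_iff]; tauto
    · intro w; rw [← hds, mem_support_append_iff]; tauto
    · intro w; rw [← hds, mem_support_append_iff]; tauto
    · simp only [length_append]; omega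
  · obtain ⟨q₁, q₂, rfl⟩ := mem_support_iff_exists_append.1 h
    rw [length_append] at hdl
    simp only [mem_support_append_iff] at hds
    have hd₂ := hd.append_comm
    rw [← append_assoc] at hd₂
    have hd₃ := hd₂.append_comm
    rw [← append_assoc] at hd₃
    refine ⟨(q₁.append q₂).reverse, (q₂.append p).reverse, (p.append q₁).reverse,
      ?_, ?_, ?_, ?_, ?_, ?_, ?_⟩
    · exact (hd.isPath_of_append_right (not_nil_of_ne hxy)).reverse
    · exact (hd₂.isPath_of_append_right (not_nil_of_ne hyz)).reverse
    · exact (hd₃.isPath_of_append_right (not_nil_of_ne hzx)).reverse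
    · intro w; rw [← hds, support_reverse, List.mem_reverse, mem_support_append_iff]; tauto
    · intro w; rw [← hds, support_reverse, List.mem_reverse, mem_support_append_iff]; tauto
    · intro w; rw [← hds, support_reverse, List.mem_reverse, mem_support_append_iff]; tauto
    · simp only [length_reverse, length_append]; omega

/-- A path between two sets contains one that only meets the sets in its ends. -/
lemma IsPath.exists_subpath_between {a b : V} {p : G.Walk a b} (hp : p.IsPath) (ha : a ∈ A)
    (hb : b ∈ B) : ∃ (a' b' : V) (q : G.Walk a' b'), q.IsPath ∧ a' ∈ A ∧ b' ∈ B ∧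
      q.support ⊆ p.support ∧ (∀ z ∈ q.support, z ∈ A → z = a') ∧
      ∀ z ∈ q.support, z ∈ B → z = b' := by
  classical
  induction hn : p.length using Nat.strong_induction_on generalizing a b with
  | _ n ih =>
  subst hn
  by_cases h : (∀ z ∈ p.support, z ∈ A → z = a) ∧ ∀ z ∈ p.support, z ∈ B → z = b
  · exact ⟨a, b, p, hp, ha, hb, fun _ h ↦ h, h.1, h.2⟩
  rw [not_and_or] at h
  push Not at h
  rcases h with ⟨z, hz, hzA, hne⟩ | ⟨z, hz, hzB, hne⟩
  · obtain ⟨a', b', q, h1, h2, h3, h4, h5⟩ :=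
      ih _ (length_dropUntil_lt_length hz hne) (hp.dropUntil hz) hzA hb rfl
    exact ⟨a', b', q, h1, h2, h3, fun _ hx ↦ support_dropUntil_subset_support p hz (h4 hx), h5⟩
  · obtain ⟨a', b', q, h1, h2, h3, h4, h5⟩ :=
      ih _ (length_takeUntil_lt_length hz hne) (hp.takeUntil hz) ha hzB rfl
    exact ⟨a', b', q, h1, h2, h3, fun _ hx ↦ support_takeUntil_subset_support p hz (h4 hx), h5⟩

/-- The cycle formed by two disjoint paths between disjoint sets and a path in each of the sets. -/
lemma exists_isCycle_of_paths {a b a' b' : V} (hAB : Disjoint A B) {p : G.Walk a b}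
    {p' : G.Walk a' b'} {q : G.Walk a a'} {r : G.Walk b b'} (hp : p.IsPath) (hp' : p'.IsPath)
    (hq : q.IsPath) (hr : r.IsPath) (hpp' : ∀ z ∈ p.support, z ∉ p'.support)
    (hqA : ∀ z ∈ q.support, z ∈ A) (hrB : ∀ z ∈ r.support, z ∈ B)
    (hpA : ∀ z ∈ p.support, z ∈ A → z = a) (hpB : ∀ z ∈ p.support, z ∈ B → z = b)
    (hpA' : ∀ z ∈ p'.support, z ∈ A → z = a') (hpB' : ∀ z ∈ p'.support, z ∈ B → z = b') :
    ∃ c : G.Walk a a, c.IsCycle ∧ q.length + r.length + 2 ≤ c.length := by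
  have hdis := Set.disjoint_left.1 hAB
  have hne : ∀ {u v : V} (w : G.Walk u v), u ≠ v → 1 ≤ w.length := fun w h ↦
    Nat.one_le_iff_ne_zero.2 fun h0 ↦ h (eq_of_length_eq_zero h0)
  have hab : a ≠ b := fun h ↦
    hdis (hqA a q.start_mem_support) (h ▸ hrB b r.start_mem_support)
  have hab' : a' ≠ b' := fun h ↦
    hdis (hqA a' q.end_mem_support) (h ▸ hrB b' r.end_mem_support)
  have hl := hne p hab
  have hl' := hne p' hab'
  have h1 : (p.append r).IsPath :=
    hp.append_of_forall_eq hr fun z hz hz' ↦ hpB z hz (hrB z hz')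
  have h2 : ((p.append r).append p'.reverse).IsPath := by
    refine h1.append_of_forall_eq hp'.reverse fun z hz hz' ↦ ?_
    rw [support_reverse, List.mem_reverse] at hz'
    rw [mem_support_append_iff] at hz
    exact hz.elim (fun hz ↦ (hpp' z hz hz').elim) (fun hz ↦ hpB' z hz' (hrB z hz))
  refine ⟨_, h2.isCycle_append_reverse hq ?_ fun z hz hz' ↦ ?_, ?_⟩
  · simp only [length_append, length_reverse]
    omega
  · have hzA := hqA z hz'
    simp only [mem_support_append_iff, support_reverse, List.mem_reverse] at hz
    rcases hz with (hz | hz) | hz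
    · exact .inl (hpA z hz hzA)
    · exact (hdis hzA (hrB z hz)).elim
    · exact .inr (hpA' z hz hzA)
  · simp only [length_append, length_reverse]
    omega

lemma IsCycle.exists_isPath_snd {v : V} {c : G.Walk v v} (hc : c.IsCycle) :
    ∃ p : G.Walk v c.snd, p.IsPath ∧ p.support ⊆ c.support ∧ p.length + 1 = c.length := by
  refine ⟨c.tail.reverse, hc.isPath_tail.reverse, fun z hz ↦ ?_, ?_⟩
  · rw [support_reverse, List.mem_reverse, support_tail_of_not_nil c hc.not_nil] at hz
    exact List.mem_of_mem_tail hz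
  · rw [length_reverse, length_tail_add_one hc.not_nil]

/-- Deleting an edge of a cycle leaves a path. -/
lemma IsCycle.exists_isPath_of_mem_edges {u v w : V} {c : G.Walk u u} (hc : c.IsCycle)
    (h : s(v, w) ∈ c.edges) : ∃ p : G.Walk v w, p.IsPath ∧ p.support ⊆ c.support ∧
      p.length + 1 = c.length := by
  classical
  have hv : v ∈ c.support := c.fst_mem_support_of_mem_edges h
  obtain ⟨d, hd, hdl, hds, hde⟩ : ∃ d : G.Walk v v, d.IsCycle ∧ d.length = c.length ∧
      (∀ z, z ∈ d.support ↔ z ∈ c.support) ∧ s(v, w) ∈ d.edges :=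
    ⟨c.rotate v hv, hc.rotate hv, by simp, by simp, (c.rotate_edges v hv).mem_iff.2 h⟩
  have hsnd : d.snd = w ∨ d.reverse.snd = w := by
    rw [snd_reverse]
    obtain ⟨x, hvx, p, rfl⟩ := not_nil_iff.1 hd.not_nil
    have hp := (cons_isCycle_iff p hvx).1 hd
    rw [edges_cons, List.mem_cons] at hde
    rcases hde with hde | hde
    · rw [snd_cons]
      exact .inl (Sym2.congr_right.1 hde).symm
    · refine .inr ?_
      rw [penultimate_cons_of_not_nil _ _ (not_nil_of_ne hvx.ne')]
      exact (hp.1.eq_penultimate_of_mem_edges hde).symm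
  rcases hsnd with rfl | rfl
  · obtain ⟨p, h1, h2, h3⟩ := hd.exists_isPath_snd
    exact ⟨p, h1, fun z hz ↦ (hds z).1 (h2 hz), h3.trans hdl⟩
  · obtain ⟨p, h1, h2, h3⟩ := hd.reverse.exists_isPath_snd
    exact ⟨p, h1, fun z hz ↦ (hds z).1 (by simpa using h2 hz), by simpa [hdl] using h3⟩

end Walk

/-- Every cycle has length at most `k`. -/
def CyclesLE (G : SimpleGraph V) (k : ℕ) : Prop :=
  ∀ (v : V) (c : G.Walk v v), c.IsCycle → c.length ≤ k

/-- `A` and `B` are the two sides of a proper separation of `G`. -/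
structure IsSeparation (G : SimpleGraph V) (A B : Set V) : Prop where
  union_eq : A ∪ B = Set.univ
  not_adj : ∀ a ∈ A, a ∉ B → ∀ b ∈ B, b ∉ A → ¬ G.Adj a b
  left_nonempty : (A \ B).Nonempty
  right_nonempty : (B \ A).Nonempty

lemma IsSeparation.symm (h : G.IsSeparation A B) : G.IsSeparation B A :=
  ⟨by rw [Set.union_comm, h.union_eq], fun b hb hbA a ha haB hab ↦
    h.not_adj a ha haB b hb hbA hab.symm, h.right_nonempty, h.left_nonempty⟩

lemma IsSeparation.of_separates (hS : G.Separates A B S) (hA : (A \ S).Nonempty)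
    (hB : (B \ S).Nonempty) :
    G.IsSeparation (S ∪ G.reachAvoiding A S) (G.reachAvoiding A S)ᶜ := by
  refine ⟨?_, ?_, ?_, ?_⟩
  · ext z
    by_cases hz : z ∈ G.reachAvoiding A S <;> simp [hz]
  · intro a _ ha b hb hb' hab
    rw [Set.mem_compl_iff, not_not] at ha
    exact hb (mem_reachAvoiding_of_adj ha hab fun h ↦ hb' (.inl h))
  · obtain ⟨a, ha, haS⟩ := hA
    have := mem_reachAvoiding (G := G) ha haS
    exact ⟨a, .inr this, fun h ↦ h this⟩
  · obtain ⟨b, hb, hbS⟩ := hB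
    have hbL : b ∉ G.reachAvoiding A S := fun h ↦
      Set.disjoint_left.1 hS.disjoint_reachAvoiding h (mem_reachAvoiding hb hbS)
    exact ⟨b, hbL, fun h ↦ h.elim hbS hbL⟩

lemma Walk.IsCycle.ncard_support {v : V} {c : G.Walk v v} (hc : c.IsCycle) :
    {z | z ∈ c.support}.ncard = c.length := by
  classical
  have h : {z | z ∈ c.support} = (c.support.tail.toFinset : Set V) := by
    ext z
    rw [Set.mem_ofPred_eq, List.coe_toFinset, Set.mem_ofPred_eq, Walk.mem_support_iff]
    refine ⟨?_, .inr⟩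
    rintro (rfl | h)
    · exact Walk.end_mem_tail_support hc.not_nil
    · exact h
  rw [h, Set.ncard_coe_finset, List.toFinset_card_of_nodup hc.support_nodup, List.length_tail,
    Walk.length_support, Nat.add_sub_cancel]

/-- In a graph without separations of order at most two, two disjoint cycles can be combined
into one that contains two thirds of their edges. -/
lemma exists_isCycle_of_disjoint [Finite V]
    (hG : ∀ A B, G.IsSeparation A B → 3 ≤ (A ∩ B).ncard) {v w : V} {c : G.Walk v v}
    {d : G.Walk w w} (hc : c.IsCycle) (hd : d.IsCycle) (hcd : ∀ z ∈ c.support, z ∉ d.support) :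
    ∃ (x : V) (e : G.Walk x x), e.IsCycle ∧ 2 * (c.length + d.length) + 6 ≤ 3 * e.length := by
  have hdis : Disjoint {z | z ∈ c.support} {z | z ∈ d.support} := Set.disjoint_left.2 hcd
  have hsep : ∀ S, G.Separates {z | z ∈ c.support} {z | z ∈ d.support} S → 3 ≤ S.ncard := by
    intro S hS
    by_contra! hS3
    have hne : ∀ {v : V} {c : G.Walk v v}, c.IsCycle → ({z | z ∈ c.support} \ S).Nonempty := by
      intro v c hc
      refine Set.nonempty_of_ncard_ne_zero fun h ↦ ?_
      have h1 := Set.le_ncard_sdiff S {z | z ∈ c.support} (Set.toFinite _)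
      have h2 := hc.ncard_support
      have h3 := hc.three_le_length
      omega
    have h := hG _ _ (IsSeparation.of_separates hS (hne hc) (hne hd))
    have h' : ((S ∪ G.reachAvoiding {z | z ∈ c.support} S) ∩
        (G.reachAvoiding {z | z ∈ c.support} S)ᶜ).ncard ≤ S.ncard := by
      refine Set.ncard_le_ncard ?_ (Set.toFinite _)
      rintro z ⟨hz | hz, hz'⟩
      · exact hz
      · exact (hz' hz).elim
    omega
  obtain ⟨a, b, p, ha, hb, hp, hpd⟩ := linked_of_forall_separates 3 G _ _ hsep
  have htrim := fun i ↦ (hp i).exists_subpath_between (ha i) (hb i)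
  choose a' b' q hq ha' hb' hqp hqA hqB using htrim
  have hqd : ∀ i j, i ≠ j → ∀ z ∈ (q i).support, z ∉ (q j).support := fun i j hij z hi hj ↦
    hij (hpd i j z (hqp i hi) (hqp j hj))
  have haa : ∀ i j, i ≠ j → a' i ≠ a' j := fun i j hij h ↦
    hqd i j hij _ (q i).start_mem_support (by rw [h]; exact (q j).start_mem_support)
  have hbb : ∀ i j, i ≠ j → b' i ≠ b' j := fun i j hij h ↦
    hqd i j hij _ (q i).end_mem_support (by rw [h]; exact (q j).end_mem_support)
  obtain ⟨p₁, p₂, p₃, hp₁, hp₂, hp₃, hs₁, hs₂, hs₃, hpl⟩ := hc.exists_arcs (ha' 0) (ha' 1) (ha' 2)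
    (haa 0 1 (by decide)) (haa 1 2 (by decide)) (haa 2 0 (by decide))
  obtain ⟨r₁, r₂, r₃, hr₁, hr₂, hr₃, ht₁, ht₂, ht₃, hrl⟩ := hd.exists_arcs (hb' 0) (hb' 1) (hb' 2)
    (hbb 0 1 (by decide)) (hbb 1 2 (by decide)) (hbb 2 0 (by decide))
  obtain ⟨e₁, he₁, hl₁⟩ := Walk.exists_isCycle_of_paths hdis (hq 0) (hq 1) hp₁ hr₁
    (hqd 0 1 (by decide)) (fun _ h ↦ hs₁ h) (fun _ h ↦ ht₁ h) (hqA 0) (hqB 0) (hqA 1) (hqB 1)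
  obtain ⟨e₂, he₂, hl₂⟩ := Walk.exists_isCycle_of_paths hdis (hq 1) (hq 2) hp₂ hr₂
    (hqd 1 2 (by decide)) (fun _ h ↦ hs₂ h) (fun _ h ↦ ht₂ h) (hqA 1) (hqB 1) (hqA 2) (hqB 2)
  obtain ⟨e₃, he₃, hl₃⟩ := Walk.exists_isCycle_of_paths hdis (hq 2) (hq 0) hp₃ hr₃
    (hqd 2 0 (by decide)) (fun _ h ↦ hs₃ h) (fun _ h ↦ ht₃ h) (hqA 2) (hqB 2) (hqA 0) (hqB 0)
  by_contra! hlong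
  have := hlong _ e₁ he₁
  have := hlong _ e₂ he₂
  have := hlong _ e₃ he₃
  omega

lemma Walk.IsCycle.exists_of_induce {u : A} {c : (G.induce A).Walk u u} (hc : c.IsCycle) :
    ∃ d : G.Walk (u : V) u, d.IsCycle ∧ d.length = c.length ∧ ∀ z ∈ d.support, z ∈ A := by
  refine ⟨c.map (Embedding.induce A).toHom, ?_, Walk.length_map _ _, fun z hz ↦ ?_⟩
  · exact (Walk.isCycle_map_iff_of_injective (f := (Embedding.induce A).toHom)
      (Embedding.induce (G := G) A).injective).2 hc
  · obtain ⟨y, -, rfl⟩ := List.mem_map.1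
      ((congrArg (z ∈ ·) (Walk.support_map (Embedding.induce A).toHom c)).mp hz)
    exact y.2

lemma CyclesLE.induce {k : ℕ} (h : G.CyclesLE k) (A : Set V) : (G.induce A).CyclesLE k := by
  intro v c hc
  obtain ⟨d, hd, hdl, -⟩ := hc.exists_of_induce
  exact hdl ▸ h _ d hd

/-- Deleting a longest cycle halves the bound on the length of cycles. -/
lemma exists_cyclesLE_induce_compl [Finite V] {k : ℕ} (hk : G.CyclesLE k)
    (hG : ∀ A B, G.IsSeparation A B → 3 ≤ (A ∩ B).ncard) :
    ∃ X : Set V, X.ncard ≤ k ∧ (G.induce Xᶜ).CyclesLE (k / 2) := by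
  classical
  by_cases hac : ∃ n, ∃ (v : V) (c : G.Walk v v), c.IsCycle ∧ c.length = n
  · have hbdd : ∀ n, (∃ (v : V) (c : G.Walk v v), c.IsCycle ∧ c.length = n) → n ≤ k := by
      rintro n ⟨v, c, hc, rfl⟩
      exact hk v c hc
    obtain ⟨n₀, hn₀⟩ := hac
    have hmax : ∀ (w : V) (d : G.Walk w w), d.IsCycle → d.length ≤
        Nat.findGreatest (fun n ↦ ∃ (v : V) (c : G.Walk v v), c.IsCycle ∧ c.length = n) k :=
      fun w d hd ↦ Nat.le_findGreatest (hk w d hd) ⟨w, d, hd, rfl⟩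
    obtain ⟨v, c, hc, hcl⟩ := Nat.findGreatest_spec
      (P := fun n ↦ ∃ (v : V) (c : G.Walk v v), c.IsCycle ∧ c.length = n) (hbdd n₀ hn₀) hn₀
    rw [← hcl] at hmax
    refine ⟨{z | z ∈ c.support}, hc.ncard_support.trans_le (hk v c hc), fun w d hd ↦ ?_⟩
    obtain ⟨d', hd', hdl, hds⟩ := hd.exists_of_induce
    obtain ⟨x, e, he, hel⟩ := exists_isCycle_of_disjoint hG hc hd' fun z hz hz' ↦ hds z hz' hz
    have h1 := hmax x e he
    have h2 := hk v c hc
    omega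
  · refine ⟨∅, by simp, fun w d hd ↦ (hac ?_).elim⟩
    obtain ⟨d', hd', -⟩ := hd.exists_of_induce
    exact ⟨_, _, d', hd', rfl⟩

/-- Adding an edge on a two-vertex separator creates no long cycle on a side of the separation,
if the other side contains a path between the two vertices. -/
lemma CyclesLE.induce_sup_edge {k : ℕ} {v w : V} (hk : G.CyclesLE k) (hvw : v ≠ w)
    (hAB : A ∩ B = {v, w}) {q : G.Walk v w} (hq : ∀ z ∈ q.support, z ∈ B) :
    ((G ⊔ edge v w).induce A).CyclesLE k := by
  classical
  intro u c hc
  obtain ⟨d, hd, hdl, hdA⟩ := hc.exists_of_induce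
  rw [← hdl]
  have hedge : ∀ e ∈ (G ⊔ edge v w).edgeSet, e ≠ s(v, w) → e ∈ G.edgeSet := by
    intro e he hne
    rw [edgeSet_sup, edgeSet_edge_of_ne hvw] at he
    exact he.resolve_right hne
  by_cases h : s(v, w) ∈ d.edges
  · obtain ⟨p, hp, hps, hpl⟩ := hd.exists_isPath_of_mem_edges h
    have h3 := hd.three_le_length
    have hpe : s(v, w) ∉ p.edges := fun h ↦ by
      have := hp.length_eq_one_of_mem_edges h
      omega
    have hpG : ∀ e ∈ p.edges, e ∈ G.edgeSet := fun e he ↦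
      hedge e (p.edges_subset_edgeSet he) fun h ↦ hpe (h ▸ he)
    have hcyc := (hp.transfer hpG).isCycle_append_reverse q.bypass_isPath
      (by rw [Walk.length_transfer]; omega) (fun z hz hz' ↦ by
        rw [Walk.support_transfer] at hz
        have : z ∈ A ∩ B := ⟨hdA z (hps hz), hq z (q.support_bypass_subset_support hz')⟩
        simpa [hAB] using this)
    have hl := hk _ _ hcyc
    have hb : q.bypass.length ≠ 0 := fun h0 ↦ hvw (Walk.eq_of_length_eq_zero h0)
    rw [Walk.length_append, Walk.length_transfer, Walk.length_reverse] at hl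
    omega
  · have hdG : ∀ e ∈ d.edges, e ∈ G.edgeSet := fun e he ↦
      hedge e (d.edges_subset_edgeSet he) fun h' ↦ h (h' ▸ he)
    have := hk _ _ (hd.transfer hdG)
    rwa [Walk.length_transfer] at this

/-- Both sides of a separation of minimum order two contain a path between the separating
vertices. -/
lemma IsSeparation.exists_walk [Finite V] {v w : V} (h : G.IsSeparation A B)
    (hmin : ∀ A' B', G.IsSeparation A' B' → (A ∩ B).ncard ≤ (A' ∩ B').ncard) (hvw : v ≠ w)
    (hAB : A ∩ B = {v, w}) : ∃ q : G.Walk v w, ∀ z ∈ q.support, z ∈ B := by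
  have hvAB : v ∈ A ∩ B := by simp [hAB]
  have hwAB : w ∈ A ∩ B := by simp [hAB]
  rw [hAB, Set.ncard_pair hvw] at hmin
  have hAB' : ∀ z ∈ A, z ∈ B → z = v ∨ z = w := fun z hA hB ↦ by
    have : z ∈ A ∩ B := ⟨hA, hB⟩
    simpa [hAB] using this
  by_contra hw
  set R := G.reachAvoiding {v} Bᶜ with hR
  have hRB : ∀ z ∈ R, z ∈ B := fun z hz ↦ not_not.1 (notMem_of_mem_reachAvoiding hz)
  have hvR : v ∈ R := mem_reachAvoiding rfl (not_not.2 hvAB.2)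
  have hRadj : ∀ y ∈ R, ∀ z ∈ B, G.Adj y z → z ∈ R := fun y hy z hz hyz ↦
    mem_reachAvoiding_of_adj hy hyz (not_not.2 hz)
  have hwR : w ∉ R := by
    rintro ⟨_, rfl, q, hq⟩
    exact hw ⟨q, fun z hz ↦ not_not.1 (hq z hz)⟩
  by_cases hBR : ∃ b ∈ B, b ∉ A ∧ b ∉ R
  · obtain ⟨b, hb, hbA, hbR⟩ := hBR
    have hsep : G.IsSeparation (A ∪ R) (B \ R) := by
      refine ⟨?_, ?_, ?_, ⟨b, ⟨hb, hbR⟩, fun h ↦ h.elim hbA hbR⟩⟩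
      · have := h.union_eq
        ext z
        have hz : z ∈ A ∪ B := this ▸ Set.mem_univ z
        by_cases hzR : z ∈ R
        · simp [hzR]
        · simpa [hzR] using hz
      · rintro a ha haB y ⟨hyB, hyR⟩ hyA hay
        by_cases haR : a ∈ R
        · exact hyR (hRadj a haR y hyB hay)
        · exact h.not_adj a (ha.resolve_right haR) (fun h ↦ haB ⟨h, haR⟩) y hyB
            (fun h ↦ hyA (.inl h)) hay
      · obtain ⟨a, haA, haB⟩ := h.left_nonempty
        exact ⟨a, .inl haA, fun h ↦ haB h.1⟩
    have h1 := hmin _ _ hsep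
    have h2 : ((A ∪ R) ∩ (B \ R)).ncard ≤ ({w} : Set V).ncard := by
      refine Set.ncard_le_ncard ?_ (Set.toFinite _)
      rintro z ⟨hz, hzB, hzR⟩
      exact (hAB' z (hz.resolve_right hzR) hzB).resolve_left fun h ↦ hzR (h ▸ hvR)
    rw [Set.ncard_singleton] at h2
    omega
  · push Not at hBR
    have hsep : G.IsSeparation A (B \ {w}) := by
      refine ⟨?_, ?_, ?_, ?_⟩
      · ext z
        have hz : z ∈ A ∪ B := h.union_eq ▸ Set.mem_univ z
        by_cases hzw : z = w
        · simp [hzw, hwAB.1]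
        · simpa [hzw] using hz
      · rintro a ha haB y ⟨hyB, -⟩ hyA hay
        by_cases haw : a = w
        · subst haw
          exact hwR (hRadj y (hBR y hyB hyA) a hwAB.2 hay.symm)
        · exact h.not_adj a ha (fun h ↦ haB ⟨h, haw⟩) y hyB hyA hay
      · exact ⟨w, hwAB.1, fun h ↦ h.2 rfl⟩
      · obtain ⟨b, hbB, hbA⟩ := h.right_nonempty
        exact ⟨b, ⟨hbB, fun h ↦ hbA (h ▸ hwAB.1)⟩, hbA⟩
    have h1 := hmin _ _ hsep
    have h2 : (A ∩ (B \ {w})).ncard ≤ ({v} : Set V).ncard := by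
      refine Set.ncard_le_ncard ?_ (Set.toFinite _)
      rintro z ⟨hzA, hzB, hzw⟩
      exact (hAB' z hzA hzB).resolve_right hzw
    rw [Set.ncard_singleton] at h2
    omega

/-- A graph with at least four vertices and no separation of order at most two has a cycle of
length at least four. -/
lemma four_le_of_cyclesLE [Finite V] {k : ℕ} (hk : G.CyclesLE k) (hV : 4 ≤ Nat.card V)
    (hG : ∀ A B, G.IsSeparation A B → 3 ≤ (A ∩ B).ncard) : 4 ≤ k := by
  classical
  have hdeg : ∀ v, 3 ≤ (G.neighborSet v).ncard := by
    intro v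
    by_contra! hlt
    have hsep : G.IsSeparation (insert v (G.neighborSet v)) {v}ᶜ := by
      refine ⟨?_, ?_, ⟨v, by simp, by simp⟩, ?_⟩
      · ext z
        by_cases hz : z = v <;> simp [hz]
      · intro a _ ha b _ hb hab
        obtain rfl : a = v := by simpa using ha
        exact hb (.inr hab)
      · have h1 := Set.ncard_insert_le v (G.neighborSet v)
        have h2 : (insert v (G.neighborSet v))ᶜ.ncard ≠ 0 := by
          have := Set.ncard_add_ncard_compl (insert v (G.neighborSet v))
          omega
        obtain ⟨z, hz⟩ := Set.nonempty_of_ncard_ne_zero h2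
        exact ⟨z, fun h ↦ hz (.inl h), hz⟩
    have h := hG _ _ hsep
    have h' : (insert v (G.neighborSet v) ∩ {v}ᶜ).ncard ≤ (G.neighborSet v).ncard := by
      refine Set.ncard_le_ncard ?_ (Set.toFinite _)
      rintro z ⟨hz, hz'⟩
      exact hz.resolve_left hz'
    omega
  have : Nonempty V := Finite.card_pos_iff.1 (by omega)
  obtain ⟨u, v, p, hp, hmax⟩ := Walk.exists_isPath_forall_isPath_length_le_length G
  have hsupp : ∀ w, G.Adj u w → w ∈ p.support := by
    intro w hw
    by_contra hwp
    have := hmax _ _ (.cons hw.symm p) ((Walk.cons_isPath_iff _ _).2 ⟨hp, hwp⟩)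
    rw [Walk.length_cons] at this
    omega
  by_contra! hk4
  have hidx : ∀ w ∈ G.neighborSet u, w ∈ ({p.getVert 1, p.getVert 2} : Set V) := by
    intro w hw
    have hwp := hsupp w hw
    have hvert := Walk.getVert_length_takeUntil hwp
    have h0 : (p.takeUntil w hwp).length ≠ 0 := fun h0 ↦ hw.ne (Walk.eq_of_length_eq_zero h0)
    have h3 : (p.takeUntil w hwp).length ≤ 2 := by
      by_contra! h3
      have hcyc : (Walk.cons (Adj.symm hw) (p.takeUntil w hwp)).IsCycle := by
        rw [Walk.cons_isCycle_iff]
        refine ⟨hp.takeUntil hwp, fun h ↦ ?_⟩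
        rw [Sym2.eq_swap] at h
        have := (hp.takeUntil hwp).length_eq_one_of_mem_edges h
        omega
      have := hk _ _ hcyc
      rw [Walk.length_cons] at this
      omega
    have : (p.takeUntil w hwp).length = 1 ∨ (p.takeUntil w hwp).length = 2 := by omega
    rcases this with h | h <;> rw [h] at hvert <;> simp [hvert]
  have h1 := Set.ncard_le_ncard hidx (Set.toFinite _)
  have h2 := Set.ncard_insert_le (p.getVert 1) {p.getVert 2}
  rw [Set.ncard_singleton] at h2
  have := hdeg u
  omega

/-- Every proper nonempty part of `S` is joined to the rest of `S` by an edge. -/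
def IsLinkedSet (G : SimpleGraph V) (S : Set V) : Prop :=
  ∀ T ⊆ S, T.Nonempty → (S \ T).Nonempty → ∃ a ∈ T, ∃ b ∈ S \ T, G.Adj a b

/-- Every connected monochromatic set has at most `k` vertices. -/
def IsClustered (G : SimpleGraph V) {α : Type*} (f : V → α) (k : ℕ) : Prop :=
  ∀ S, G.IsLinkedSet S → (∀ a ∈ S, ∀ b ∈ S, f a = f b) → S.ncard ≤ k

/-- Every colouring of a clique of size at most two extends to a colouring with clustering `k`
in which the clique is separated from the vertices of its own colours. -/
def HasExtensions (G : SimpleGraph V) (m k : ℕ) : Prop :=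
  ∀ C : Set V, G.IsClique C → C.ncard ≤ 2 → ∀ c : V → Fin m, ∃ f : V → Fin m,
    (∀ v ∈ C, f v = c v) ∧ (∀ v ∈ C, ∀ w ∉ C, G.Adj v w → f v ≠ f w) ∧ G.IsClustered f k

lemma IsLinkedSet.mono (hGH : G ≤ H) (h : G.IsLinkedSet S) : H.IsLinkedSet S := by
  intro T hTS hT hST
  obtain ⟨a, ha, b, hb, hab⟩ := h T hTS hT hST
  exact ⟨a, ha, b, hb, hGH hab⟩

lemma IsLinkedSet.induce (h : G.IsLinkedSet S) (hSA : S ⊆ A) :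
    (G.induce A).IsLinkedSet (Subtype.val ⁻¹' S) := by
  rintro T hTS ⟨t, ht⟩ ⟨s, hs, hsT⟩
  obtain ⟨_, ⟨a, ha, rfl⟩, b, ⟨hb, hbT⟩, hab⟩ := h (Subtype.val '' T)
    (by rintro _ ⟨a, ha, rfl⟩; exact hTS ha) ⟨t, t, ht, rfl⟩
    ⟨s, hs, by rintro ⟨t', ht', he⟩; exact hsT (Subtype.ext he ▸ ht')⟩
  exact ⟨a, ha, ⟨b, hSA hb⟩, ⟨hb, fun h ↦ hbT ⟨_, h, rfl⟩⟩, hab⟩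

lemma IsClustered.ncard_le {α : Type*} {f : A → α} {k : ℕ} (hf : (G.induce A).IsClustered f k)
    (hS : G.IsLinkedSet S) (hSA : S ⊆ A)
    (hmono : ∀ a (ha : a ∈ S) b (hb : b ∈ S), f ⟨a, hSA ha⟩ = f ⟨b, hSA hb⟩) : S.ncard ≤ k := by
  have h := hf _ (hS.induce hSA) fun a ha b hb ↦ hmono a ha b hb
  rwa [← Set.ncard_image_of_injective _ Subtype.val_injective, Subtype.image_preimage_coe,
    Set.inter_eq_right.2 hSA] at h

lemma HasExtensions.anti {m k : ℕ} (hGH : G ≤ H) (h : H.HasExtensions m k) :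
    G.HasExtensions m k := by
  intro C hC hC2 c
  obtain ⟨f, h1, h2, h3⟩ := h C (hC.mono hGH) hC2 c
  exact ⟨f, h1, fun v hv w hw hvw ↦ h2 v hv w hw (hGH hvw),
    fun S hS hm ↦ h3 S (hS.mono hGH) hm⟩

lemma IsClique.preimage_val {C : Set V} (hC : G.IsClique C) (A : Set V) :
    (G.induce A).IsClique (Subtype.val ⁻¹' C) :=
  fun _ ha _ hb hne ↦ hC ha hb fun h ↦ hne (Subtype.ext h)

lemma ncard_preimage_val_le [Finite V] (A C : Set V) :
    (Subtype.val ⁻¹' C : Set A).ncard ≤ C.ncard := by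
  rw [← Set.ncard_image_of_injective _ Subtype.val_injective, Subtype.image_preimage_coe]
  exact Set.ncard_le_ncard Set.inter_subset_right (Set.toFinite _)

lemma IsSeparation.exists_extension [Finite V] {m k : ℕ} (h : G.IsSeparation A B)
    (hcl : G.IsClique (A ∩ B)) (h2 : (A ∩ B).ncard ≤ 2) (hA : (G.induce A).HasExtensions m k)
    (hB : (G.induce B).HasExtensions m k) {C : Set V} (hC : G.IsClique C) (hC2 : C.ncard ≤ 2)
    (hCA : C ⊆ A) (c : V → Fin m) : ∃ f : V → Fin m, (∀ v ∈ C, f v = c v) ∧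
      (∀ v ∈ C, ∀ w ∉ C, G.Adj v w → f v ≠ f w) ∧ G.IsClustered f k := by
  classical
  have hun : ∀ z, z ∉ A → z ∈ B := fun z hz ↦ by
    have : z ∈ A ∪ B := h.union_eq ▸ Set.mem_univ z
    exact this.resolve_left hz
  obtain ⟨f₁, hf₁, hs₁, hc₁⟩ := hA _ (hC.preimage_val A)
    ((ncard_preimage_val_le A C).trans hC2) fun v ↦ c v
  obtain ⟨f₂, hf₂, hs₂, hc₂⟩ := hB _ (hcl.preimage_val B)
    ((ncard_preimage_val_le B _).trans h2) fun v ↦ if hv : (v : V) ∈ A then f₁ ⟨v, hv⟩ else c v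
  set f : V → Fin m := fun v ↦ if hv : v ∈ A then f₁ ⟨v, hv⟩ else f₂ ⟨v, hun v hv⟩ with hf
  have hfA : ∀ v (hv : v ∈ A), f v = f₁ ⟨v, hv⟩ := fun v hv ↦ by simp [hf, hv]
  have hfB : ∀ v (hv : v ∈ B), f v = f₂ ⟨v, hv⟩ := fun v hv ↦ by
    by_cases hvA : v ∈ A
    · rw [hfA v hvA, hf₂ ⟨v, hv⟩ ⟨hvA, hv⟩, dif_pos hvA]
    · simp [hf, hvA]
  have hcross : ∀ a ∈ A, ∀ b ∉ A, G.Adj a b → f a ≠ f b := by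
    intro a ha b hb hab
    have haB : a ∈ B := by
      by_contra haB
      exact h.not_adj a ha haB b (hun b hb) hb hab
    rw [hfB a haB, hfB b (hun b hb)]
    exact hs₂ ⟨a, haB⟩ ⟨ha, haB⟩ ⟨b, hun b hb⟩ (fun h ↦ hb h.1) hab
  refine ⟨f, fun v hv ↦ ?_, fun v hv w hw hvw ↦ ?_, fun S hS hm ↦ ?_⟩
  · rw [hfA v (hCA hv)]
    exact hf₁ ⟨v, hCA hv⟩ hv
  · by_cases hwA : w ∈ A
    · rw [hfA v (hCA hv), hfA w hwA]
      exact hs₁ ⟨v, hCA hv⟩ hv ⟨w, hwA⟩ hw hvw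
    · exact hcross v (hCA hv) w hwA hvw
  · by_cases hSA : S ⊆ A
    · exact hc₁.ncard_le hS hSA fun a ha b hb ↦ by rw [← hfA, ← hfA]; exact hm a ha b hb
    · have hSB : S ⊆ B := by
        obtain ⟨s, hs, hsA⟩ := Set.not_subset.1 hSA
        intro z hz
        by_contra hzB
        have hzA : z ∈ A := by
          by_contra hzA
          exact hzB (hun z hzA)
        obtain ⟨a, ha, b, hb, hab⟩ := hS (S ∩ A) Set.inter_subset_left ⟨z, hz, hzA⟩
          ⟨s, hs, fun h ↦ hsA h.2⟩
        exact hcross a ha.2 b (fun h ↦ hb.2 ⟨hb.1, h⟩) hab (hm a ha.1 b hb.1)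
      exact hc₂.ncard_le hS hSB fun a ha b hb ↦ by rw [← hfB, ← hfB]; exact hm a ha b hb

/-- Colourings extend if they do so on both sides of a separation along a small clique. -/
lemma IsSeparation.hasExtensions [Finite V] {m k : ℕ} (h : G.IsSeparation A B)
    (hcl : G.IsClique (A ∩ B)) (h2 : (A ∩ B).ncard ≤ 2) (hA : (G.induce A).HasExtensions m k)
    (hB : (G.induce B).HasExtensions m k) : G.HasExtensions m k := by
  intro C hC hC2 c
  have hun : ∀ z, z ∈ A ∨ z ∈ B := fun z ↦ by
    have : z ∈ A ∪ B := h.union_eq ▸ Set.mem_univ z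
    exact this
  by_cases hCA : C ⊆ A
  · exact h.exists_extension hcl h2 hA hB hC hC2 hCA c
  · refine h.symm.exists_extension (by rwa [Set.inter_comm]) (by rwa [Set.inter_comm]) hB hA hC
      hC2 (fun a ha ↦ ?_) c
    obtain ⟨b, hb, hbA⟩ := Set.not_subset.1 hCA
    by_contra haB
    have haA : a ∈ A := (hun a).resolve_right haB
    exact h.not_adj a haA haB b ((hun b).resolve_left hbA) hbA
      (hC ha hb fun h ↦ hbA (h ▸ haA))

lemma hasExtensions_of_card_le [Finite V] {m k : ℕ} (hV : Nat.card V ≤ 3) (hm : 3 ≤ m)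
    (hk : 2 ≤ k) : G.HasExtensions m k := by
  classical
  intro C _ hC2 c
  obtain ⟨e⟩ : Nonempty (↥Cᶜ ↪ ↥(c '' C)ᶜ) := by
    have := Fintype.ofFinite ↥Cᶜ
    have := Fintype.ofFinite ↥(c '' C)ᶜ
    refine Function.Embedding.nonempty_of_card_le ?_
    rw [← Nat.card_eq_fintype_card, ← Nat.card_eq_fintype_card, Nat.card_coe_set_eq,
      Nat.card_coe_set_eq]
    have h1 := Set.ncard_add_ncard_compl C
    have h2 := Set.ncard_add_ncard_compl (c '' C)
    have h3 : (c '' C).ncard ≤ C.ncard := Set.ncard_image_le (Set.toFinite _)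
    rw [Nat.card_fin] at h2
    omega
  set f : V → Fin m := fun v ↦ if hv : v ∈ C then c v else e ⟨v, hv⟩ with hf
  have hfC : ∀ v ∈ C, f v = c v := fun v hv ↦ by simp [hf, hv]
  have hfe : ∀ v (hv : v ∉ C), f v = e ⟨v, hv⟩ := fun v hv ↦ by simp [hf, hv]
  have hne : ∀ v ∈ C, ∀ w ∉ C, f v ≠ f w := by
    intro v hv w hw h
    rw [hfC v hv, hfe w hw] at h
    exact (e ⟨w, hw⟩).2 ⟨v, hv, h⟩
  refine ⟨f, hfC, fun v hv w hw _ ↦ hne v hv w hw, fun S hS hm ↦ ?_⟩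
  by_cases hSC : S ⊆ C
  · exact (Set.ncard_le_ncard hSC (Set.toFinite _)).trans (hC2.trans hk)
  · obtain ⟨s, hs, hsC⟩ := Set.not_subset.1 hSC
    have hout : ∀ a ∈ S, a ∉ C := fun a ha haC ↦ hne a haC s hsC (hm a ha s hs)
    have h1 : S.ncard ≤ 1 := by
      rw [Set.ncard_le_one (Set.toFinite _)]
      intro a ha b hb
      have := hm a ha b hb
      rw [hfe a (hout a ha), hfe b (hout b hb)] at this
      exact congrArg Subtype.val (e.injective (Subtype.ext this))
    omega

/-- Colourings extend if deleting at most `k` vertices leaves a graph that is colourable with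
three colours less. -/
lemma hasExtensions_of_induce_compl [Finite V] {m m' k : ℕ} {X : Set V} (hX : X.ncard ≤ k)
    (hm : m' + 3 ≤ m) (hk : 2 ≤ k) {g : ↥Xᶜ → Fin m'} (hg : (G.induce Xᶜ).IsClustered g k) :
    G.HasExtensions m k := by
  classical
  intro C _ hC2 c
  have hcC := (Set.ncard_image_le (f := c) (Set.toFinite C)).trans hC2
  have hcard := Set.ncard_add_ncard_compl (c '' C)
  rw [Nat.card_fin] at hcard
  obtain ⟨γ, hγ⟩ : (c '' C)ᶜ.Nonempty := Set.nonempty_of_ncard_ne_zero (by omega)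
  obtain ⟨e⟩ : Nonempty (Fin m' ↪ ↥(insert γ (c '' C))ᶜ) := by
    have := Fintype.ofFinite ↥(insert γ (c '' C))ᶜ
    refine Function.Embedding.nonempty_of_card_le ?_
    rw [Fintype.card_fin, ← Nat.card_eq_fintype_card, Nat.card_coe_set_eq]
    have h1 := Set.ncard_add_ncard_compl (insert γ (c '' C))
    have h2 := Set.ncard_insert_le γ (c '' C)
    rw [Nat.card_fin] at h1
    omega
  set f : V → Fin m := fun v ↦
    if v ∈ C then c v else if hv : v ∈ X then γ else e (g ⟨v, hv⟩) with hf
  have hfC : ∀ v ∈ C, f v = c v := fun v hv ↦ by simp [hf, hv]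
  have hfX : ∀ v ∉ C, v ∈ X → f v = γ := fun v hv hvX ↦ by simp [hf, hv, hvX]
  have hfe : ∀ v ∉ C, ∀ hv : v ∉ X, f v = e (g ⟨v, hv⟩) := fun v hv hvX ↦ by simp [hf, hv, hvX]
  have hne : ∀ v ∈ C, ∀ w ∉ C, f v ≠ f w := by
    intro v hv w hw h
    rw [hfC v hv] at h
    by_cases hwX : w ∈ X
    · rw [hfX w hw hwX] at h
      exact hγ ⟨v, hv, h⟩
    · rw [hfe w hw hwX] at h
      exact (e _).2 (.inr ⟨v, hv, h⟩)
  refine ⟨f, hfC, fun v hv w hw _ ↦ hne v hv w hw, fun S hS hmono ↦ ?_⟩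
  by_cases hSC : S ⊆ C
  · exact (Set.ncard_le_ncard hSC (Set.toFinite _)).trans (hC2.trans hk)
  obtain ⟨s, hs, hsC⟩ := Set.not_subset.1 hSC
  have hout : ∀ a ∈ S, a ∉ C := fun a ha haC ↦ hne a haC s hsC (hmono a ha s hs)
  by_cases hSX : S ⊆ X
  · exact (Set.ncard_le_ncard hSX (Set.toFinite _)).trans hX
  obtain ⟨t, ht, htX⟩ := Set.not_subset.1 hSX
  have houtX : S ⊆ Xᶜ := by
    intro a ha haX
    have := hmono a ha t ht
    rw [hfX a (hout a ha) haX, hfe t (hout t ht) htX] at this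
    exact (e _).2 (.inl this.symm)
  refine hg.ncard_le hS houtX fun a ha b hb ↦ ?_
  have := hmono a ha b hb
  rw [hfe a (hout a ha) (houtX ha), hfe b (hout b hb) (houtX hb)] at this
  exact e.injective (Subtype.ext this)

/-- Along a separation of minimum order at most two, colourings extend if they do so for the
smaller graphs of the same circumference. -/
lemma IsSeparation.hasExtensions_of_minimal [Finite V] {m k : ℕ} (hk : G.CyclesLE k)
    (h : G.IsSeparation A B) (h2 : (A ∩ B).ncard ≤ 2)
    (hmin : ∀ A' B', G.IsSeparation A' B' → (A ∩ B).ncard ≤ (A' ∩ B').ncard)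
    (ih : ∀ (D : Set V) (H : SimpleGraph D), Nat.card D < Nat.card V → H.CyclesLE k →
      H.HasExtensions m k) : G.HasExtensions m k := by
  have hlt : ∀ {A B : Set V}, G.IsSeparation A B → Nat.card A < Nat.card V := by
    intro A B h
    obtain ⟨b, -, hb⟩ := h.right_nonempty
    rw [Nat.card_coe_set_eq, ← Set.ncard_univ]
    exact Set.ncard_lt_ncard ⟨Set.subset_univ _, fun h ↦ hb (h (Set.mem_univ b))⟩ (Set.toFinite _)
  rcases h2.lt_or_eq with h1 | h2'
  · refine h.hasExtensions (fun a ha b hb hne ↦ (hne ?_).elim) h2 (ih A _ (hlt h) (hk.induce A))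
      (ih B _ (hlt h.symm) (hk.induce B))
    exact (Set.ncard_le_one (Set.toFinite _)).1 (Nat.le_of_lt_succ h1) a ha b hb
  · obtain ⟨v, w, hvw, hAB⟩ := Set.ncard_eq_two.1 h2'
    have hBA : B ∩ A = {v, w} := by rw [Set.inter_comm, hAB]
    obtain ⟨q, hq⟩ := h.exists_walk hmin hvw hAB
    obtain ⟨r, hr⟩ := h.symm.exists_walk (by simpa [Set.inter_comm] using hmin) hvw hBA
    have hv : v ∈ A ∩ B := by simp [hAB]
    have hw : w ∈ A ∩ B := by simp [hAB]
    have hsep : (G ⊔ edge v w).IsSeparation A B := by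
      refine ⟨h.union_eq, fun a ha haB b hb hbA hab ↦ ?_, h.left_nonempty, h.right_nonempty⟩
      rcases hab with hab | hab
      · exact h.not_adj a ha haB b hb hbA hab
      · rw [edge_adj] at hab
        rcases hab.1 with ⟨rfl, -⟩ | ⟨rfl, -⟩
        · exact haB hv.2
        · exact haB hw.2
    refine HasExtensions.anti (H := G ⊔ edge v w) le_sup_left (hsep.hasExtensions ?_ h2
      (ih A _ (hlt h) (hk.induce_sup_edge hvw hAB hq))
      (ih B _ (hlt h.symm) (hk.induce_sup_edge hvw hBA hr)))
    have hadj : (G ⊔ edge v w).Adj v w := .inr (by simp [edge_adj, hvw])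
    rw [hAB]
    rintro a (rfl | rfl) b (rfl | rfl) hne
    · exact (hne rfl).elim
    · exact hadj
    · exact hadj.symm
    · exact (hne rfl).elim

theorem hasExtensions_of_cyclesLE {g : ℕ → ℕ} (hg : ∀ k, 2 ≤ k → 3 ≤ g k)
    (hstep : ∀ k, 4 ≤ k → g (k / 2) + 3 ≤ g k) (k : ℕ) (hk : 2 ≤ k) (V : Type u) [Finite V]
    (G : SimpleGraph V) (hG : G.CyclesLE k) : G.HasExtensions (g k) k := by
  classical
  induction k using Nat.strong_induction_on generalizing V with
  | _ k ihk =>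
  induction hn : Nat.card V using Nat.strong_induction_on generalizing V with
  | _ n ih =>
  subst hn
  rcases le_or_gt (Nat.card V) 3 with hV | hV
  · exact hasExtensions_of_card_le hV (hg k hk) hk
  by_cases hsep : ∃ n, n ≤ 2 ∧ ∃ A B, G.IsSeparation A B ∧ (A ∩ B).ncard = n
  · obtain ⟨hn2, A, B, hAB, hABn⟩ := Nat.find_spec hsep
    refine hAB.hasExtensions_of_minimal hG (hABn.trans_le hn2) (fun A' B' h' ↦ ?_)
      fun D H hD hH ↦ ih _ hD D H hH rfl
    by_contra! hlt
    exact Nat.find_min hsep (hlt.trans_eq hABn) ⟨by omega, A', B', h', rfl⟩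
  · have hsep' : ∀ A B, G.IsSeparation A B → 3 ≤ (A ∩ B).ncard := by
      intro A B hAB
      by_contra! hlt
      exact hsep ⟨_, Nat.le_of_lt_succ hlt, A, B, hAB, rfl⟩
    have hk4 := four_le_of_cyclesLE hG hV hsep'
    obtain ⟨X, hX, hXc⟩ := exists_cyclesLE_induce_compl hG hsep'
    have h3 := hg (k / 2) (by omega)
    obtain ⟨f, -, -, hf⟩ := ihk (k / 2) (by omega) (by omega) _ _ hXc ∅ (by simp) (by simp)
      fun _ ↦ ⟨0, by omega⟩
    exact hasExtensions_of_induce_compl hX (hstep k hk4) hk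
      fun S hS hm ↦ (hf S hS hm).trans (Nat.div_le_self k 2)

lemma IsClustered.hasClustering {m k : ℕ} {f : V → Fin m} (h : G.IsClustered f k) :
    G.HasClustering f k := by
  intro i K
  rw [← Set.ncard_image_of_injective _ Subtype.val_injective]
  refine h _ ?_ ?_
  · rintro T hTS ⟨t, ht⟩ ⟨s, hs, hsT⟩
    obtain ⟨t, htK, rfl⟩ := hTS ht
    obtain ⟨s, hsK, rfl⟩ := hs
    rw [ConnectedComponent.mem_supp_iff] at htK hsK
    obtain ⟨p⟩ := ConnectedComponent.exact (htK.trans hsK.symm)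
    obtain ⟨d, -, hd1, hd2⟩ := p.exists_boundary_dart (Subtype.val ⁻¹' T) ht hsT
    obtain ⟨a, haK, ha⟩ := hTS hd1
    obtain rfl := Subtype.ext ha
    refine ⟨d.fst, hd1, d.snd, ⟨⟨d.snd, ?_, rfl⟩, hd2⟩, d.adj⟩
    rw [ConnectedComponent.mem_supp_iff] at haK ⊢
    rw [← haK]
    exact ConnectedComponent.sound d.adj.symm.reachable
  · rintro _ ⟨a, -, rfl⟩ _ ⟨b, -, rfl⟩
    exact a.2.trans b.2.symm

lemma HasClustering.hasDefect [Finite V] {m k : ℕ} {f : V → Fin m} (h : G.HasClustering f k) :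
    G.HasDefect f k := by
  intro v
  refine le_trans ?_ (h (f v) ((G.induce {w | f w = f v}).connectedComponentMk ⟨v, rfl⟩))
  rw [← Set.ncard_image_of_injective _ Subtype.val_injective]
  refine Set.ncard_le_ncard ?_ (Set.toFinite _)
  rintro w ⟨hvw, hw⟩
  refine ⟨⟨w, hw⟩, ?_, rfl⟩
  rw [ConnectedComponent.mem_supp_iff]
  have hadj : (G.induce {w | f w = f v}).Adj ⟨w, hw⟩ ⟨v, rfl⟩ := hvw.symm
  exact ConnectedComponent.sound hadj.reachable

lemma defectiveChromaticNumber_le_clusteredChromaticNumber (𝒢 : GraphClass.{u}) :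
    defectiveChromaticNumber 𝒢 ≤ clusteredChromaticNumber 𝒢 := by
  refine le_iInf₂ fun m hm ↦ iInf₂_le m ?_
  obtain ⟨c, hc⟩ := hm
  refine ⟨c, fun V _ G hG ↦ ?_⟩
  obtain ⟨f, hf⟩ := hc V G hG
  exact ⟨f, hf.hasDefect⟩

lemma cyclesLE_of_circumference_le [Finite V] {k : ℕ} (h : G.circumference ≤ k) :
    G.CyclesLE k := by
  intro v c hc
  have hac : ¬ G.IsAcyclic := fun hac ↦ hac c hc
  rw [circumference, if_neg hac] at h
  have hmem : c.length ∈ {n : ℕ | ∃ (v : V) (w : G.Walk v v), w.IsCycle ∧ w.length = n} :=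
    ⟨v, c, hc, rfl⟩
  refine le_trans (le_csSup ⟨Nat.card V, ?_⟩ hmem) h
  rintro n ⟨w, d, hd, rfl⟩
  rw [← hd.ncard_support, ← Set.ncard_univ]
  exact Set.ncard_le_ncard (Set.subset_univ _) (Set.toFinite _)

lemma cyclesLE_of_not_hasPathOfOrder {k : ℕ} (h : ¬ G.HasPathOfOrder (k + 1)) :
    G.CyclesLE k := by
  intro v c hc
  by_contra! hlt
  refine h ⟨_, _, c.tail.take k, hc.isPath_tail.take k, ?_⟩
  have := Walk.length_tail_add_one hc.not_nil
  rw [Walk.length_support, Walk.take_length]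
  omega

lemma colorableWithClustering_of_cyclesLE [Finite V] {k : ℕ} (hk : 2 ≤ k) (hG : G.CyclesLE k) :
    G.ColorableWithClustering ⌊3 * Real.logb 2 (k : ℝ)⌋₊ k := by
  have hlog : ∀ k : ℕ, 2 ≤ k → 1 ≤ Real.logb 2 (k : ℝ) := by
    intro k hk
    have hk' : (2 : ℝ) ≤ k := by exact_mod_cast hk
    rw [Real.le_logb_iff_rpow_le one_lt_two (by linarith), Real.rpow_one]
    exact hk'
  have hg : ∀ k : ℕ, 2 ≤ k → 3 ≤ ⌊3 * Real.logb 2 (k : ℝ)⌋₊ := by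
    intro k hk
    refine Nat.le_floor ?_
    have := hlog k hk
    push_cast
    linarith
  have hstep : ∀ k : ℕ, 4 ≤ k →
      ⌊3 * Real.logb 2 ((k / 2 : ℕ) : ℝ)⌋₊ + 3 ≤ ⌊3 * Real.logb 2 (k : ℝ)⌋₊ := by
    intro k hk
    have h1 := hlog (k / 2) (by omega)
    have hpos : (0 : ℝ) < ((k / 2 : ℕ) : ℝ) := by
      have : 0 < k / 2 := by omega
      exact_mod_cast this
    have hle : (2 : ℝ) * ((k / 2 : ℕ) : ℝ) ≤ k := by exact_mod_cast Nat.mul_div_le k 2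
    have h2 : Real.logb 2 ((k / 2 : ℕ) : ℝ) + 1 ≤ Real.logb 2 (k : ℝ) := by
      have h3 := Real.logb_le_logb_of_le one_lt_two (by positivity) hle
      rw [Real.logb_mul two_ne_zero hpos.ne', Real.logb_self_eq_one one_lt_two] at h3
      linarith
    refine Nat.le_floor ?_
    have h4 := Nat.floor_le (a := 3 * Real.logb 2 ((k / 2 : ℕ) : ℝ)) (by linarith)
    push_cast
    linarith
  have h3 := hg k hk
  obtain ⟨f, -, -, hf⟩ := hasExtensions_of_cyclesLE (g := fun k ↦ ⌊3 * Real.logb 2 (k : ℝ)⌋₊)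
    hg hstep k hk V G hG ∅ (by simp) (by simp) fun _ ↦ ⟨0, by omega⟩
  exact ⟨f, hf.hasClustering⟩

end SimpleGraph

theorem mainTheorem8 (k : ℕ) (hk : 2 ≤ k) :
    (∀ (V : Type u) [Finite V] (G : SimpleGraph V), G.circumference ≤ k →
      G.ColorableWithClustering ⌊3 * Real.logb 2 (k : ℝ)⌋₊ k) ∧
    (SimpleGraph.defectiveChromaticNumber.{u} (SimpleGraph.circumferenceClass k) ≤
        SimpleGraph.clusteredChromaticNumber.{u} (SimpleGraph.circumferenceClass k) ∧
      SimpleGraph.clusteredChromaticNumber.{u} (SimpleGraph.circumferenceClass k) ≤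
        ((⌊3 * Real.logb 2 (k : ℝ)⌋₊ : ℕ) : ℕ∞)) ∧
    (∀ (V : Type u) [Finite V] (G : SimpleGraph V), ¬ G.HasPathOfOrder (k + 1) →
      G.ColorableWithClustering ⌊3 * Real.logb 2 (k : ℝ)⌋₊ k) ∧
    (SimpleGraph.defectiveChromaticNumber.{u} (SimpleGraph.noLongPathClass k) ≤
        SimpleGraph.clusteredChromaticNumber.{u} (SimpleGraph.noLongPathClass k) ∧
      SimpleGraph.clusteredChromaticNumber.{u} (SimpleGraph.noLongPathClass k) ≤
        ((⌊3 * Real.logb 2 (k : ℝ)⌋₊ : ℕ) : ℕ∞)) := by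
  have hC : ∀ (V : Type u) [Finite V] (G : SimpleGraph V), G.circumference ≤ k →
      G.ColorableWithClustering ⌊3 * Real.logb 2 (k : ℝ)⌋₊ k := fun _ _ _ hG ↦
    SimpleGraph.colorableWithClustering_of_cyclesLE hk
      (SimpleGraph.cyclesLE_of_circumference_le hG)
  have hH : ∀ (V : Type u) [Finite V] (G : SimpleGraph V), ¬ G.HasPathOfOrder (k + 1) →
      G.ColorableWithClustering ⌊3 * Real.logb 2 (k : ℝ)⌋₊ k := fun _ _ _ hG ↦
    SimpleGraph.colorableWithClustering_of_cyclesLE hk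
      (SimpleGraph.cyclesLE_of_not_hasPathOfOrder hG)
  exact ⟨hC, ⟨SimpleGraph.defectiveChromaticNumber_le_clusteredChromaticNumber _,
      iInf₂_le _ ⟨k, hC⟩⟩, hH,
    SimpleGraph.defectiveChromaticNumber_le_clusteredChromaticNumber _, iInf₂_le _ ⟨k, hH⟩⟩
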